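/- Identify $\mathfrak u^*(n)$ with the real vector space of Hermitian $n\times n$ matrices, with inner product $\langle\xi,\eta\rangle=\frac12\mathrm{Tr}(\xi\eta)$, norm $\|\xi\|=\langle\xi,\xi\rangle^{1/2}$ and Lie bracket $[\xi,\eta]=-\mathrm i(\xi\eta-\eta\xi)$. Identify $\mathfrak u(n)$ with the dual of $\mathfrak u^*(n)$, and write $\xi^\flat=\langle\xi,\cdot\rangle\in\mathfrak u(n)$ and $(\mathrm{ad}^*_\xi\Gamma)(\eta)=\Gamma([\xi,\eta])$ for $\xi,\eta\in\mathfrak u^*(n)$, $\Gamma\in\mathfrak u(n)$. Let $0=t_0<t_1<\dots<t_N=T$ with $T>0$, let $\rho_0,\dots,\rho_N$ be density matrices (positive semidefinite, of trace one), $H_0\in\mathfrak u^*(n)$, $\epsilon>0$, and let $\mathfrak h\subseteq\mathfrak u^*(n)$ be a real linear subspace. An admissible process on $[a,b]$ consists of a state $(\rho,H)$ with values in $\mathfrak u^*(n)\times\mathfrak u^*(n)$, continuous on $[a,b]$ and smooth on $]a,b[$, and a control $u$ with values in $\mathfrak h$, smooth on $]a,b[$ with finite one-sided limits at $a$ and $b$,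 such that $\dot\rho=[H,\rho]$ and $\dot H=u$ on $]a,b[$. For $j=1,\dots,N$ let $P_j$ be the problem of minimizing $$J_j=\int_{t_{j-1}}^{t_j}\tfrac12\|u(t)\|^2\,dt+\frac1{2\epsilon}\|\rho(t_j)-\rho_j\|^2$$ over the admissible processes on $[t_{j-1},t_j]$ with a prescribed initial state $(\rho(t_{j-1}),H(t_{j-1}))$ and free final state. In the chain $P_1,\dots,P_N$ the initial state of $P_1$ is $(\rho_0,H_0)$, and the initial state of $P_{j}$, $j\ge2$, is the final state of the solution of $P_{j-1}$ (so that the state is continuous on $[0,T]$). Theorem. Let $u$ be an optimal control for the chain of problems $P_1,\dots,P_N$ (that is, it is optimal for each $P_j$), with associated state trajectory $(\rho,H)$. Then there is a piecewise-continuous costate trajectory $(\Gamma,\Pi)$ with values in $\mathfrak u(n)\times\mathfrak u(n)$ (continuous on each $]t_{j-1},t_j[$ with finite one-sided limits at $t_{j-1}$ and $t_j$) such that, on each interval $]t_{j-1},t_j[$, $$\dot\rho=[H,\rho],\qquad \dot H=u,\qquad \dot\Gamma=-\mathrm{ad}^*_H\Gamma,\qquad \dot\Pi=\mathrm{ad}^*_\rho\Gamma,\qquad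 \Pi|_{\mathfrak h}=u^\flat|_{\mathfrak h}$$ (the last equation being simply $\Pi=u^\flat$ when $\mathfrak h=\mathfrak u^*(n)$), with $\rho(0)=\rho_0$, $H(0)=H_0$, and $$\Gamma(t_j^-)=-\frac1\epsilon(\rho(t_j)-\rho_j)^\flat,\qquad \Pi(t_j^-)=0,\qquad j=1,\dots,N.$$ -/

import Mathlib

open Set Filter Topology
open scoped ContDiff ComplexOrder

noncomputable section

namespace QuantumSpline

/-- The space `𝔲*(n)`, identified as usual with the real vector space of Hermitian `n × n`
matrices. It is made a type of its own so that its norm is the one given by the inner product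
`⟨ξ, η⟩ = ½ Tr (ξ η)` below. -/
def UStar (n : ℕ) : Type :=
  selfAdjoint.submodule ℝ (Matrix (Fin n) (Fin n) ℂ)

namespace UStar

variable {n : ℕ}

instance : AddCommGroup (UStar n) :=
  inferInstanceAs (AddCommGroup (selfAdjoint.submodule ℝ (Matrix (Fin n) (Fin n) ℂ)))

instance : Module ℝ (UStar n) :=
  inferInstanceAs (Module ℝ (selfAdjoint.submodule ℝ (Matrix (Fin n) (Fin n) ℂ)))

instance : FiniteDimensional ℝ (UStar n) :=
  inferInstanceAs (FiniteDimensional ℝ (selfAdjoint.submodule ℝ (Matrix (Fin n) (Fin n) ℂ)))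

/-- The Hermitian matrix underlying an element of `𝔲*(n)`. -/
def toMatrix (ξ : UStar n) : Matrix (Fin n) (Fin n) ℂ := Subtype.val ξ

/-- The element of `𝔲*(n)` given by a Hermitian matrix. -/
def ofMatrix (A : Matrix (Fin n) (Fin n) ℂ) (hA : A.IsHermitian) : UStar n := ⟨A, hA⟩

theorem isHermitian (ξ : UStar n) : ξ.toMatrix.IsHermitian := ξ.2

theorem toMatrix_injective : Function.Injective (toMatrix (n := n)) := Subtype.val_injective

@[simp] theorem toMatrix_ofMatrix (A : Matrix (Fin n) (Fin n) ℂ) (hA : A.IsHermitian) :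
    (ofMatrix A hA).toMatrix = A := rfl

@[simp] theorem toMatrix_zero : (0 : UStar n).toMatrix = 0 := rfl

@[simp] theorem toMatrix_add (ξ η : UStar n) :
    (ξ + η).toMatrix = ξ.toMatrix + η.toMatrix := rfl

@[simp] theorem toMatrix_smul (c : ℝ) (ξ : UStar n) :
    (c • ξ).toMatrix = c • ξ.toMatrix := rfl

theorem trace_mul_self (ξ : UStar n) :
    (ξ.toMatrix * ξ.toMatrix).trace.re = ∑ i, ∑ j, ‖ξ.toMatrix i j‖ ^ 2 := by
  simp only [Matrix.trace, Matrix.diag, Matrix.mul_apply, Complex.re_sum]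
  refine Finset.sum_congr rfl fun i _ => Finset.sum_congr rfl fun j _ => ?_
  have h : ξ.toMatrix j i = star (ξ.toMatrix i j) := (ξ.isHermitian.apply j i).symm
  rw [h, Complex.star_def, Complex.mul_conj, Complex.ofReal_re, Complex.normSq_eq_norm_sq]

/-- The inner product `⟨ξ, η⟩ = ½ Tr (ξ η)` of `𝔲*(n)`; the trace of a product of two Hermitian
matrices is real, so taking its real part only changes the type. -/
@[reducible] def innerCore : InnerProductSpace.Core ℝ (UStar n) where
  inner ξ η := (1 / 2 : ℝ) * (ξ.toMatrix * η.toMatrix).trace.re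
  conj_inner_symm ξ η := by
    simp [Matrix.trace_mul_comm η.toMatrix ξ.toMatrix]
  re_inner_nonneg ξ := by
    simp only [trace_mul_self, RCLike.re_to_real]
    positivity
  add_left ξ η ζ := by
    simp [add_mul, Matrix.trace_add, mul_add]
  smul_left ξ η r := by
    simp only [toMatrix_smul, Matrix.smul_mul, Matrix.trace_smul, Complex.real_smul,
      Complex.re_ofReal_mul, conj_trivial]
    ring
  definite ξ h := by
    simp only [trace_mul_self] at h
    have h2 : ∑ i, ∑ j, ‖ξ.toMatrix i j‖ ^ 2 = 0 := by linarith
    apply toMatrix_injective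
    ext i j
    rw [Finset.sum_eq_zero_iff_of_nonneg (fun _ _ => by positivity)] at h2
    have h3 := h2 i (Finset.mem_univ _)
    rw [Finset.sum_eq_zero_iff_of_nonneg (fun _ _ => by positivity)] at h3
    simpa using h3 j (Finset.mem_univ _)

instance : NormedAddCommGroup (UStar n) := innerCore.toNormedAddCommGroup

instance : InnerProductSpace ℝ (UStar n) := InnerProductSpace.ofCore innerCore.toCore

instance : CompleteSpace (UStar n) := FiniteDimensional.complete ℝ (UStar n)

theorem inner_def (ξ η : UStar n) :
    inner ℝ ξ η = (1 / 2 : ℝ) * (ξ.toMatrix * η.toMatrix).trace.re := rfl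

/-- The Lie bracket of `𝔲*(n)`: `[ξ, η] = -i (ξ η - η ξ)` on Hermitian matrices, the transport of
the commutator of `𝔲(n)` along `ξ ↦ -i ξ`. -/
instance : Bracket (UStar n) (UStar n) where
  bracket ξ η := ofMatrix
    ((-Complex.I) • (ξ.toMatrix * η.toMatrix - η.toMatrix * ξ.toMatrix)) (by
      rw [Matrix.IsHermitian, Matrix.conjTranspose_smul, Matrix.conjTranspose_sub,
        Matrix.conjTranspose_mul, Matrix.conjTranspose_mul, ξ.isHermitian.eq, η.isHermitian.eq,
        star_neg, Complex.star_def, Complex.conj_I, neg_neg, neg_smul, ← smul_neg, neg_sub])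

@[simp] theorem toMatrix_lie (ξ η : UStar n) :
    ⁅ξ, η⁆.toMatrix =
      (-Complex.I) • (ξ.toMatrix * η.toMatrix - η.toMatrix * ξ.toMatrix) := rfl

instance : LieRing (UStar n) where
  add_lie ξ η ζ := toMatrix_injective <| by
    simp only [toMatrix_lie, toMatrix_add, ← smul_add]
    congr 1
    noncomm_ring
  lie_add ξ η ζ := toMatrix_injective <| by
    simp only [toMatrix_lie, toMatrix_add, ← smul_add]
    congr 1
    noncomm_ring
  lie_self ξ := toMatrix_injective <| by simp
  leibniz_lie ξ η ζ := toMatrix_injective <| by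
    simp only [toMatrix_lie, toMatrix_add, Matrix.mul_smul, Matrix.smul_mul, ← smul_sub,
      ← smul_add]
    congr 2
    noncomm_ring

instance : LieAlgebra ℝ (UStar n) where
  lie_smul c ξ η := toMatrix_injective <| by
    simp only [toMatrix_lie, toMatrix_smul, Matrix.mul_smul, Matrix.smul_mul, ← smul_sub]
    rw [smul_comm]

end UStar

variable {n : ℕ}

/-- Density states: elements of `𝔲*(n)` that are positive semidefinite and have trace one. -/
def IsDensity (ρ : UStar n) : Prop :=
  ρ.toMatrix.PosSemidef ∧ ρ.toMatrix.trace = 1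

/-- The space `𝔲(n)` of costates, as the dual of `𝔲*(n)`. -/
abbrev Costate (n : ℕ) : Type := StrongDual ℝ (UStar n)

/-- The isomorphism `♭ : 𝔲*(n) → 𝔲(n)`, `ξ ↦ ⟨ξ, ·⟩`, given by the inner product. -/
def flat (ξ : UStar n) : Costate n := InnerProductSpace.toDual ℝ (UStar n) ξ

/-- The coadjoint action: `ad*_ξ Γ = Γ ∘ ad_ξ`, that is, `(ad*_ξ Γ)(η) = Γ([ξ, η])`. -/
def coad (ξ : UStar n) (Γ : Costate n) : Costate n :=
  Γ.comp (LinearMap.toContinuousLinearMap (LieAlgebra.ad ℝ (UStar n) ξ))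

/-- `(ρ, H, u)` is an admissible process on `[a, b]`: the state `(ρ, H)` is continuous on `[a, b]`
(so that it has one-sided limits at the end points) and smooth on `]a, b[`; the control `u`, with
values in `𝔥`, is smooth on `]a, b[` with finite one-sided limits at `a` and `b`; and the control
system `ρ' = [H, ρ]`, `H' = u` holds on `]a, b[`. -/
structure IsAdmissibleOn (𝔥 : Submodule ℝ (UStar n)) (a b : ℝ)
    (ρ H : ℝ → UStar n) (u : ℝ → 𝔥) : Prop where
  continuousOn_state : ContinuousOn ρ (Icc a b)
  continuousOn_ham : ContinuousOn H (Icc a b)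
  contDiffOn_state : ContDiffOn ℝ ∞ ρ (Ioo a b)
  contDiffOn_ham : ContDiffOn ℝ ∞ H (Ioo a b)
  contDiffOn_control : ContDiffOn ℝ ∞ u (Ioo a b)
  rightLimit_control : ∃ v : 𝔥, Tendsto u (𝓝[>] a) (𝓝 v)
  leftLimit_control : ∃ v : 𝔥, Tendsto u (𝓝[<] b) (𝓝 v)
  hasDerivAt_state : ∀ s ∈ Ioo a b, HasDerivAt ρ ⁅H s, ρ s⁆ s
  hasDerivAt_ham : ∀ s ∈ Ioo a b, HasDerivAt H (u s : UStar n) s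

/-- The Bolza cost `∫_a^b ½ ‖u‖² dt + (1/ε) · ½ ‖ρ(b) - target‖²` of one subproblem. -/
def cost (𝔥 : Submodule ℝ (UStar n)) (ε a b : ℝ) (target : UStar n)
    (ρ : ℝ → UStar n) (u : ℝ → 𝔥) : ℝ :=
  (∫ s in a..b, 1 / 2 * ‖(u s : UStar n)‖ ^ 2) + 1 / ε * (1 / 2 * ‖ρ b - target‖ ^ 2)

/-- `(ρ, H, u)` solves the subproblem on `[a, b]` with the initial state `(ρ(a), H(a))` and free
final state: it is admissible on `[a, b]` and minimizes the cost among the admissible processes on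
`[a, b]` that have the same initial state. -/
def IsOptimalOn (𝔥 : Submodule ℝ (UStar n)) (ε a b : ℝ) (target : UStar n)
    (ρ H : ℝ → UStar n) (u : ℝ → 𝔥) : Prop :=
  IsAdmissibleOn 𝔥 a b ρ H u ∧
    ∀ (σ K : ℝ → UStar n) (v : ℝ → 𝔥), IsAdmissibleOn 𝔥 a b σ K v → σ a = ρ a → K a = H a →
      cost 𝔥 ε a b target ρ u ≤ cost 𝔥 ε a b target σ v

/-- `u` is the optimal control, with state trajectory `(ρ, H)`, of the chain of the problems
`P_1, …, P_N` on `[t_0, t_1], …, [t_{N-1}, t_N]`: the state is continuous on `[t_0, t_N]`, starts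
at `(ρ_0, H_0)`, and for every `j` the process solves the subproblem `P_j` with target `ρ_j`, the
initial state of `P_j` being the final state of the preceding subproblem. -/
structure IsOptimalChain {N : ℕ} (𝔥 : Submodule ℝ (UStar n)) (ε : ℝ) (t : Fin (N + 1) → ℝ)
    (target : Fin (N + 1) → UStar n) (H₀ : UStar n)
    (ρ H : ℝ → UStar n) (u : ℝ → 𝔥) : Prop where
  continuousOn_state : ContinuousOn ρ (Icc (t 0) (t (Fin.last N)))
  continuousOn_ham : ContinuousOn H (Icc (t 0) (t (Fin.last N)))
  initial_state : ρ (t 0) = target 0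
  initial_ham : H (t 0) = H₀
  isOptimalOn : ∀ j : Fin N,
    IsOptimalOn 𝔥 ε (t j.castSucc) (t j.succ) (target j.succ) ρ H u

/-- Piecewise continuity with respect to `t_0 < … < t_N`: continuous on every `]t_{j-1}, t_j[`,
with finite one-sided limits at both end points. -/
def PiecewiseContinuous {N : ℕ} {F : Type*} [TopologicalSpace F] (t : Fin (N + 1) → ℝ)
    (f : ℝ → F) : Prop :=
  ∀ j : Fin N, ContinuousOn f (Ioo (t j.castSucc) (t j.succ)) ∧
    (∃ y, Tendsto f (𝓝[>] (t j.castSucc)) (𝓝 y)) ∧ ∃ y, Tendsto f (𝓝[<] (t j.succ)) (𝓝 y)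

end QuantumSpline

end

/-! Each subproblem fixes its initial state and leaves its final state free, so it can be treated
alone. The costates `Γ`, `P` are defined by solving the adjoint equations backwards from the
prescribed final values; only the relation between `P` and `u` needs optimality. Replace `u` by `u +
d • v`; then `H` becomes `H + d • w` with `w' = v`, `w a = 0`, and `ρ` becomes some `σ`. Along the
adjoint equations the derivative of `Γ (σ - ρ) + d * P w` is `d * P v` plus `d * Γ ⁅w, σ - ρ⁆`.
Grönwall gives `σ - ρ = O(d)`, so the last term is `O(d²)`, and no derivative of the flow with
respect to the control is needed. Since `Γ b` is minus the differential of the terminal cost, the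
total cost grows by at most `d * ∫ (⟨u, v⟩ - P v) + C * d ^ 2` (`IsAdmissibleOn.exists_cost_le`).
Optimality makes this integral nonnegative for every admissible direction `v`. For `v` the
representative of `P` on `𝔥` minus `u` the integrand is `-‖v‖²`, hence `v = 0`. This direction is
allowed because `P`, obtained from linear equations with smooth coefficients, is itself smooth. -/

/-! ### Linear differential equations: existence, smoothness, Grönwall -/

section LinearODE

variable {E : Type*} [NormedAddCommGroup E] [NormedSpace ℝ E]

/-- The integral equation of a linear initial value problem with continuous coefficients is
solvable on the whole interval: it is a contraction for a weighted supremum norm. -/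
theorem exists_continuous_eq_add_integral [CompleteSpace E] {a b : ℝ} (hab : a ≤ b)
    {A : ℝ → E →L[ℝ] E} (hA : Continuous A) {M : ℝ} (hM : ∀ s, ‖A s‖ ≤ M) (x₀ : E) :
    ∃ x : ℝ → E, Continuous x ∧ ∀ s ∈ Icc a b, x s = x₀ + ∫ r in a..s, A r (x r) := by
  have hM0 : 0 ≤ M := (norm_nonneg _).trans (hM 0)
  -- The contraction constant will be `M / l ≤ 1 / 2`; the summand `1` keeps `l` positive when `M =
  -- 0`.
  set l : ℝ := 2 * M + 1 with hl
  have hl0 : 0 < l := by positivity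
  have hcont (z : C(Icc a b, E)) : Continuous fun r : ℝ =>
      A r (Real.exp (l * (r - a)) • z (projIcc a b hab r)) := by
    refine hA.clm_apply (Continuous.smul (by fun_prop) ?_)
    exact z.continuous.comp continuous_projIcc
  -- Here `z s` stands for `exp (-l (s - a)) • x s`, which turns the weighted norm of `x` into the
  -- usual supremum norm of `z`.
  let F (z : C(Icc a b, E)) : C(Icc a b, E) :=
    { toFun := fun s => Real.exp (-(l * ((s : ℝ) - a))) •
        (x₀ + ∫ r in a..(s : ℝ), A r (Real.exp (l * (r - a)) • z (projIcc a b hab r)))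
      continuous_toFun := by
        refine Continuous.smul (by fun_prop) (continuous_const.add ?_)
        exact (intervalIntegral.continuous_primitive
          (fun _ _ => (hcont z).intervalIntegrable _ _) a).comp continuous_subtype_val }
  have hF : ContractingWith (1 / 2) F := by
    refine ⟨by norm_num, LipschitzWith.of_dist_le_mul fun z y => ?_⟩
    rw [ContinuousMap.dist_le (by positivity)]
    rintro ⟨s, hs⟩
    have hdiff : F z ⟨s, hs⟩ - F y ⟨s, hs⟩ = Real.exp (-(l * (s - a))) •
        ∫ r in a..s, A r (Real.exp (l * (r - a)) • (z - y) (projIcc a b hab r)) := by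
      simp only [F, ContinuousMap.coe_mk, ← smul_sub, add_sub_add_left_eq_sub,
        ← intervalIntegral.integral_sub ((hcont z).intervalIntegrable a s)
          ((hcont y).intervalIntegrable a s), ← map_sub, ContinuousMap.sub_apply]
    have hderiv (r : ℝ) : HasDerivAt (fun r => M * dist z y / l * Real.exp (l * (r - a)))
        (M * dist z y * Real.exp (l * (r - a))) r := by
      have := ((((hasDerivAt_id r).sub_const a).const_mul l).exp).const_mul (M * dist z y / l)
      refine this.congr_deriv ?_
      simp only [id]
      field_simp
    have hint : ‖∫ r in a..s, A r (Real.exp (l * (r - a)) • (z - y) (projIcc a b hab r))‖ ≤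
        M * dist z y / l * Real.exp (l * (s - a)) - M * dist z y / l * Real.exp (l * (a - a)) := by
      rw [← intervalIntegral.integral_eq_sub_of_hasDerivAt (fun r _ => hderiv r)
        (Continuous.intervalIntegrable (by fun_prop) _ _)]
      refine intervalIntegral.norm_integral_le_of_norm_le hs.1 (Eventually.of_forall fun r _ => ?_)
        (Continuous.intervalIntegrable (by fun_prop) _ _)
      refine ((A r).le_opNorm _).trans ?_
      rw [norm_smul, Real.norm_of_nonneg (Real.exp_pos _).le, mul_assoc,
        mul_comm (dist z y)]
      refine mul_le_mul (hM r) (mul_le_mul_of_nonneg_left ?_ (Real.exp_pos _).le)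
        (by positivity) hM0
      rw [dist_eq_norm]
      exact (z - y).norm_coe_le_norm _
    rw [dist_eq_norm, hdiff, norm_smul, Real.norm_of_nonneg (Real.exp_pos _).le]
    calc Real.exp (-(l * (s - a))) * _
        ≤ Real.exp (-(l * (s - a))) * (M * dist z y / l * Real.exp (l * (s - a))) := by
          refine mul_le_mul_of_nonneg_left (hint.trans ?_) (Real.exp_pos _).le
          have : 0 ≤ M * dist z y / l * Real.exp (l * (a - a)) := by positivity
          linarith
      _ = M / l * dist z y := by
          rw [Real.exp_neg]
          field_simp
      _ ≤ _ := by
          refine mul_le_mul_of_nonneg_right ?_ dist_nonneg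
          rw [div_le_iff₀ hl0]
          push_cast
          linarith
  set z := ContractingWith.fixedPoint F hF
  have hfix : F z = z := hF.fixedPoint_isFixedPt
  refine ⟨fun r => Real.exp (l * (r - a)) • z (projIcc a b hab r),
    Continuous.smul (by fun_prop) (z.continuous.comp continuous_projIcc), fun s hs => ?_⟩
  have h := congrArg (fun y : C(Icc a b, E) => Real.exp (l * (s - a)) • y ⟨s, hs⟩) hfix
  simp only [F, ContinuousMap.coe_mk, smul_smul, ← Real.exp_add, add_neg_cancel, Real.exp_zero,
    one_smul] at h
  simp only [projIcc_of_mem hab hs]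
  exact h.symm

/-- Global existence for linear differential equations with prescribed initial value. -/
theorem exists_linear_ode [CompleteSpace E] {a b : ℝ} (hab : a ≤ b)
    {A : ℝ → E →L[ℝ] E} (hA : ContinuousOn A (Icc a b)) (x₀ : E) :
    ∃ x : ℝ → E, ContinuousOn x (Icc a b) ∧ x a = x₀ ∧
      ∀ s ∈ Ioo a b, HasDerivAt x (A s (x s)) s := by
  obtain ⟨M, hM⟩ := isCompact_Icc.exists_bound_of_continuousOn hA
  have hA' : Continuous (IccExtend hab ((Icc a b).domRestrict A)) :=
    continuous_IccExtend_iff.2 hA.domRestrict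
  obtain ⟨x, hx, hxi⟩ := exists_continuous_eq_add_integral hab hA'
    (M := M) (fun s => hM _ (projIcc a b hab s).2) x₀
  refine ⟨x, hx.continuousOn, by simpa using hxi a (left_mem_Icc.2 hab), fun s hs => ?_⟩
  have hd := intervalIntegral.integral_hasDerivAt_right
    ((hA'.clm_apply hx).intervalIntegrable a s)
    ((hA'.clm_apply hx).stronglyMeasurableAtFilter _ _) (hA'.clm_apply hx).continuousAt
  rw [IccExtend_of_mem hab _ (Ioo_subset_Icc_self hs)] at hd
  refine (hd.const_add x₀).congr_of_eventuallyEq ?_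
  filter_upwards [Icc_mem_nhds hs.1 hs.2] with r hr using hxi r hr

/-- Global existence for linear differential equations with prescribed final value. -/
theorem exists_linear_ode_of_final [CompleteSpace E] {a b : ℝ} (hab : a ≤ b)
    {A : ℝ → E →L[ℝ] E} (hA : ContinuousOn A (Icc a b)) (x₁ : E) :
    ∃ x : ℝ → E, ContinuousOn x (Icc a b) ∧ x b = x₁ ∧
      ∀ s ∈ Ioo a b, HasDerivAt x (A s (x s)) s := by
  have hmaps : MapsTo (fun s => a + b - s) (Icc a b) (Icc a b) := fun s hs =>
    ⟨by linarith [hs.2], by linarith [hs.1]⟩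
  have hrefl : ContinuousOn (fun s => a + b - s) (Icc a b) := by fun_prop
  -- Reversing time by `s ↦ a + b - s` changes the sign of the coefficient.
  obtain ⟨y, hy, hya, hyd⟩ := exists_linear_ode hab (hA.comp hrefl hmaps).neg x₁
  refine ⟨fun s => y (a + b - s), hy.comp hrefl hmaps, by simpa using hya, fun s hs => ?_⟩
  have h := hyd (a + b - s) ⟨by linarith [hs.2], by linarith [hs.1]⟩
  have h2 := h.scomp s ((hasDerivAt_id s).const_sub (a + b))
  simpa [Function.comp_def] using h2

/-- Solutions of a linear differential equation with smooth coefficients are smooth. -/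
theorem contDiffOn_of_linear_ode {s : Set ℝ} (hs : IsOpen s) {A : ℝ → E →L[ℝ] E}
    (hA : ContDiffOn ℝ ∞ A s) {x : ℝ → E} (hx : ∀ r ∈ s, HasDerivAt x (A r (x r)) r) :
    ContDiffOn ℝ ∞ x s := by
  -- Bootstrapping: if `x` is `C^m`, so is `x' = A x`, and `x` is `C^(m+1)`.
  refine contDiffOn_infty.2 fun m => ?_
  induction m with
  | zero => exact contDiffOn_zero.2 fun r hr => (hx r hr).continuousAt.continuousWithinAt
  | succ m ih =>
    rw [Nat.cast_succ, contDiffOn_succ_iff_deriv_of_isOpen hs]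
    refine ⟨fun r hr => (hx r hr).differentiableAt.differentiableWithinAt, by simp, ?_⟩
    exact ((hA.of_le (by exact_mod_cast le_top)).clm_apply ih).congr fun r hr => (hx r hr).deriv

/-- A primitive of a smooth function is smooth. -/
theorem contDiffOn_of_hasDerivAt {s : Set ℝ} (hs : IsOpen s) {x f : ℝ → E}
    (hf : ContDiffOn ℝ ∞ f s) (hx : ∀ r ∈ s, HasDerivAt x (f r) r) : ContDiffOn ℝ ∞ x s :=
  (contDiffOn_infty_iff_deriv_of_isOpen hs).2
    ⟨fun r hr => (hx r hr).differentiableAt.differentiableWithinAt,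
      hf.congr fun r hr => (hx r hr).deriv⟩

/-- A continuous function on an interval has a primitive vanishing at a given point. -/
theorem exists_primitive [CompleteSpace E] {a b c : ℝ} (hab : a ≤ b) {f : ℝ → E}
    (hf : ContinuousOn f (Icc a b)) :
    ∃ x : ℝ → E, Continuous x ∧ x c = 0 ∧ ∀ s ∈ Ioo a b, HasDerivAt x (f s) s := by
  have hf' : Continuous (IccExtend hab ((Icc a b).domRestrict f)) :=
    continuous_IccExtend_iff.2 hf.domRestrict
  refine ⟨fun s => ∫ r in c..s, IccExtend hab ((Icc a b).domRestrict f) r,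
    intervalIntegral.continuous_primitive (fun _ _ => hf'.intervalIntegrable _ _) c,
    intervalIntegral.integral_same, fun s hs => ?_⟩
  have hd := intervalIntegral.integral_hasDerivAt_right (hf'.intervalIntegrable c s)
    (hf'.stronglyMeasurableAtFilter _ _) hf'.continuousAt
  rwa [IccExtend_of_mem hab _ (Ioo_subset_Icc_self hs)] at hd

/-- Grönwall's inequality for a function vanishing at the left end point, with the derivative
known in the open interval only. -/
theorem norm_le_gronwallBound_of_hasDerivAt_Ioo {a b K c : ℝ} {x x' : ℝ → E}
    (hx : ContinuousOn x (Icc a b)) (hx' : ContinuousOn x' (Icc a b)) (ha : x a = 0)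
    (hd : ∀ s ∈ Ioo a b, HasDerivAt x (x' s) s)
    (hb : ∀ s ∈ Icc a b, ‖x' s‖ ≤ K * ‖x s‖ + c) :
    ∀ s ∈ Icc a b, ‖x s‖ ≤ gronwallBound 0 K c (s - a) := by
  refine norm_le_gronwallBound_of_norm_deriv_right_le hx (f' := x') (fun s hs => ?_) (by simp [ha])
    fun s hs => hb s (Ico_subset_Icc_self hs)
  -- At `a` the right derivative is the limit of the derivatives from inside.
  rcases hs.1.eq_or_lt with rfl | has
  · refine hasDerivWithinAt_Ici_of_tendsto_deriv (s := Ioo a b)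
      (fun r hr => (hd r hr).differentiableAt.differentiableWithinAt)
      ((hx a (left_mem_Icc.2 hs.2.le)).mono Ioo_subset_Icc_self) (Ioo_mem_nhdsGT hs.2) ?_
    have h1 : Tendsto x' (𝓝[>] a) (𝓝 (x' a)) := by
      rw [← nhdsWithin_Ioo_eq_nhdsGT hs.2]
      exact (hx' a (left_mem_Icc.2 hs.2.le)).mono Ioo_subset_Icc_self
    refine h1.congr' ?_
    filter_upwards [Ioo_mem_nhdsGT hs.2] with r hr using (hd r hr).deriv.symm
  · exact (hd s ⟨has, hs.2⟩).hasDerivWithinAt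

end LinearODE
-- Bilinear control systems and their adjoint equations
section BilinearODE

variable {E : Type*} [NormedAddCommGroup E] [NormedSpace ℝ E] (B : E →L[ℝ] E →L[ℝ] E) {a b : ℝ}

theorem exists_bilinear_bound {f : ℝ → E} (hf : ContinuousOn f (Icc a b)) :
    ∃ M : ℝ, 0 ≤ M ∧ ∀ s ∈ Icc a b, ∀ y, ‖B (f s) y‖ ≤ M * ‖y‖ := by
  obtain ⟨M, hM⟩ := isCompact_Icc.exists_bound_of_continuousOn (B.continuous.comp_continuousOn hf)
  exact ⟨|M|, abs_nonneg M, fun s hs y => (B (f s)).le_of_opNorm_le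
    ((hM s hs).trans (le_abs_self M)) y⟩

theorem exists_dual_bilinear_bound {f : ℝ → E} (hf : ContinuousOn f (Icc a b))
    {Γ : ℝ → StrongDual ℝ E} (hΓ : ContinuousOn Γ (Icc a b)) :
    ∃ M : ℝ, 0 ≤ M ∧ ∀ s ∈ Icc a b, ∀ y, ‖Γ s (B (f s) y)‖ ≤ M * ‖y‖ := by
  obtain ⟨M, hM⟩ := isCompact_Icc.exists_bound_of_continuousOn
    (hΓ.clm_comp (B.continuous.comp_continuousOn hf))
  exact ⟨|M|, abs_nonneg M, fun s hs y => ((Γ s).comp (B (f s))).le_of_opNorm_le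
    ((hM s hs).trans (le_abs_self M)) y⟩

/-- Existence and regularity for `x' = B (K, x)` with given `K` and initial value. -/
theorem exists_bilinear_ode [CompleteSpace E] (hab : a ≤ b) {K : ℝ → E}
    (hK : ContinuousOn K (Icc a b)) (hKs : ContDiffOn ℝ ∞ K (Ioo a b)) (x₀ : E) :
    ∃ x : ℝ → E, ContinuousOn x (Icc a b) ∧ ContDiffOn ℝ ∞ x (Ioo a b) ∧ x a = x₀ ∧
      ∀ s ∈ Ioo a b, HasDerivAt x (B (K s) (x s)) s := by
  obtain ⟨x, hx, hxa, hxd⟩ := exists_linear_ode hab (B.continuous.comp_continuousOn hK) x₀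
  exact ⟨x, hx, contDiffOn_of_linear_ode isOpen_Ioo (B.contDiff.comp_contDiffOn hKs) hxd, hxa, hxd⟩

/-- The adjoint equations of a bilinear control system, with prescribed final values. -/
theorem exists_bilinear_adjoint (hab : a ≤ b) {x K : ℝ → E}
    (hx : ContinuousOn x (Icc a b)) (hxs : ContDiffOn ℝ ∞ x (Ioo a b))
    (hK : ContinuousOn K (Icc a b)) (hKs : ContDiffOn ℝ ∞ K (Ioo a b)) (Γ₁ : StrongDual ℝ E) :
    ∃ Γ P : ℝ → StrongDual ℝ E, ContinuousOn Γ (Icc a b) ∧ ContinuousOn P (Icc a b) ∧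
      (∀ s ∈ Ioo a b, HasDerivAt Γ (-(Γ s).comp (B (K s))) s) ∧
      (∀ s ∈ Ioo a b, HasDerivAt P ((Γ s).comp (B (x s))) s) ∧
      ContDiffOn ℝ ∞ P (Ioo a b) ∧ Γ b = Γ₁ ∧ P b = 0 := by
  -- With `L` the costate equation is a linear equation `Γ' = L (K) Γ` in the dual space.
  obtain ⟨L, hL⟩ : ∃ L : E →L[ℝ] StrongDual ℝ E →L[ℝ] StrongDual ℝ E,
      ∀ y Γ, L y Γ = -Γ.comp (B y) :=
    ⟨-((ContinuousLinearMap.compL ℝ E E ℝ).flip.comp B), fun _ _ => rfl⟩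
  obtain ⟨Γ, hΓ, hΓb, hΓd⟩ :=
    exists_linear_ode_of_final hab (L.continuous.comp_continuousOn hK) Γ₁
  obtain ⟨P, hP, hPb, hPd⟩ := exists_primitive (c := b) hab
    (hΓ.clm_comp (B.continuous.comp_continuousOn hx))
  have hΓs := contDiffOn_of_linear_ode isOpen_Ioo (L.contDiff.comp_contDiffOn hKs) hΓd
  simp only [Function.comp_apply, hL] at hΓd
  exact ⟨Γ, P, hΓ, hP.continuousOn, hΓd, hPd, contDiffOn_of_hasDerivAt isOpen_Ioo
    (hΓs.clm_comp (B.contDiff.comp_contDiffOn hxs)) hPd, hΓb, hPb⟩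

end BilinearODE

/-! ### Representing functionals on a subspace -/

section RieszProj

variable {E : Type*} [NormedAddCommGroup E] [InnerProductSpace ℝ E] [CompleteSpace E]
  (K : Submodule ℝ E) [K.HasOrthogonalProjection]

/-- The vector of a subspace that represents the restriction of a functional to it. -/
noncomputable def rieszProj : StrongDual ℝ E →L[ℝ] K :=
  K.orthogonalProjectionOnto.comp
    (InnerProductSpace.toDual ℝ E).symm.toLinearIsometry.toContinuousLinearMap

theorem inner_rieszProj (Γ : StrongDual ℝ E) (v : K) :
    inner ℝ (rieszProj K Γ : E) (v : E) = Γ v := by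
  have h : rieszProj K Γ = K.orthogonalProjectionOnto ((InnerProductSpace.toDual ℝ E).symm Γ) := rfl
  rw [h, ← Submodule.coe_inner, Submodule.inner_orthogonalProjectionOnto_eq_of_mem_right,
    InnerProductSpace.toDual_symm_apply]

theorem contDiffOn_rieszProj {P : ℝ → StrongDual ℝ E} {s : Set ℝ} (hP : ContDiffOn ℝ ∞ P s) :
    ContDiffOn ℝ ∞ (fun r => rieszProj K (P r)) s :=
  (rieszProj K).contDiff.comp_contDiffOn hP

theorem continuousOn_rieszProj {P : ℝ → StrongDual ℝ E} {s : Set ℝ} (hP : ContinuousOn P s) :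
    ContinuousOn (fun r => rieszProj K (P r)) s :=
  (rieszProj K).continuous.comp_continuousOn hP

end RieszProj

/-! ### The maximum principle on one interval -/

namespace QuantumSpline
variable {n : ℕ}

/-- The adjoint representation of `𝔲*(n)` as a continuous bilinear map. -/
noncomputable def adL (n : ℕ) : UStar n →L[ℝ] UStar n →L[ℝ] UStar n :=
  LinearMap.toContinuousLinearMap
    ((LinearMap.toContinuousLinearMap (𝕜 := ℝ) (E := UStar n) (F' := UStar n)).toLinearMap ∘ₗ
      LinearMap.mk₂ ℝ (fun ξ η : UStar n => ⁅ξ, η⁆) add_lie smul_lie lie_add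
        (fun c ξ η => lie_smul c ξ η))

@[simp] theorem adL_apply (ξ η : UStar n) : adL n ξ η = ⁅ξ, η⁆ := rfl

theorem coad_apply (ξ η : UStar n) (Γ : Costate n) : coad ξ Γ η = Γ ⁅ξ, η⁆ := rfl

theorem flat_apply (ξ η : UStar n) : flat ξ η = inner ℝ ξ η := rfl

section OneInterval

variable {𝔥 : Submodule ℝ (UStar n)} {a b ε : ℝ} {target : UStar n} {ρ H : ℝ → UStar n}
  {u : ℝ → 𝔥}

/-- Admissibility sees the control only inside the interval, so its arbitrary values at the end
points may be replaced by the one-sided limits. This gives a control continuous on the closed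
interval. -/
theorem IsAdmissibleOn.congr_control (h : IsAdmissibleOn 𝔥 a b ρ H u) {u' : ℝ → 𝔥}
    (hab : a < b) (hu : EqOn u' u (Ioo a b)) : IsAdmissibleOn 𝔥 a b ρ H u' where
  continuousOn_state := h.continuousOn_state
  continuousOn_ham := h.continuousOn_ham
  contDiffOn_state := h.contDiffOn_state
  contDiffOn_ham := h.contDiffOn_ham
  contDiffOn_control := h.contDiffOn_control.congr hu
  rightLimit_control := h.rightLimit_control.imp fun _ hv => hv.congr' <| by
    filter_upwards [Ioo_mem_nhdsGT hab] with s hs using (hu hs).symm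
  leftLimit_control := h.leftLimit_control.imp fun _ hv => hv.congr' <| by
    filter_upwards [Ioo_mem_nhdsLT hab] with s hs using (hu hs).symm
  hasDerivAt_state := h.hasDerivAt_state
  hasDerivAt_ham s hs := by simpa only [hu hs] using h.hasDerivAt_ham s hs

theorem cost_congr_control {u' : ℝ → 𝔥} (hab : a ≤ b) (hu : EqOn u' u (Ioo a b)) :
    cost 𝔥 ε a b target ρ u' = cost 𝔥 ε a b target ρ u := by
  rw [cost, cost, intervalIntegral.integral_congr_Ioo_of_le hab
    (g := fun s => 1 / 2 * ‖(u s : UStar n)‖ ^ 2) fun s hs => by simp only [hu hs]]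

theorem IsOptimalOn.congr_control (h : IsOptimalOn 𝔥 ε a b target ρ H u) {u' : ℝ → 𝔥}
    (hab : a < b) (hu : EqOn u' u (Ioo a b)) : IsOptimalOn 𝔥 ε a b target ρ H u' := by
  refine ⟨h.1.congr_control hab hu, fun σ K v hv hσ hK => ?_⟩
  rw [cost_congr_control hab.le hu]
  exact h.2 σ K v hv hσ hK

theorem IsAdmissibleOn.exists_control_continuousOn (h : IsAdmissibleOn 𝔥 a b ρ H u) :
    ∃ u' : ℝ → 𝔥, ContinuousOn u' (Icc a b) ∧ EqOn u' u (Ioo a b) := by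
  obtain ⟨_, ha⟩ := h.rightLimit_control
  obtain ⟨_, hb⟩ := h.leftLimit_control
  refine ⟨extendFrom (Ioo a b) u,
    continuousOn_Icc_extendFrom_Ioo h.contDiffOn_control.continuousOn ha hb, fun s hs => ?_⟩
  exact extendFrom_eq (subset_closure hs)
    (h.contDiffOn_control.continuousOn s hs)

/-- The perturbation of an admissible process by adding a multiple of `v` to the control. -/
theorem IsAdmissibleOn.exists_perturbation (h : IsAdmissibleOn 𝔥 a b ρ H u) (hab : a < b)
    (hu : ContinuousOn u (Icc a b)) {v : ℝ → 𝔥} (hv : ContinuousOn v (Icc a b))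
    (hv' : ContDiffOn ℝ ∞ v (Ioo a b)) {w : ℝ → UStar n} (hw : ContinuousOn w (Icc a b))
    (hwd : ∀ s ∈ Ioo a b, HasDerivAt w (v s) s) (d : ℝ) :
    ∃ σ : ℝ → UStar n, σ a = ρ a ∧ IsAdmissibleOn 𝔥 a b σ (H + d • w) (u + d • v) := by
  have hK : ContinuousOn (H + d • w) (Icc a b) := h.continuousOn_ham.add (hw.const_smul d)
  have hws : ContDiffOn ℝ ∞ w (Ioo a b) :=
    contDiffOn_of_hasDerivAt isOpen_Ioo (𝔥.subtypeL.contDiff.comp_contDiffOn hv') hwd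
  have hKs : ContDiffOn ℝ ∞ (H + d • w) (Ioo a b) := h.contDiffOn_ham.add (hws.const_smul d)
  obtain ⟨σ, hσ, hσs, hσa, hσd⟩ := exists_bilinear_ode (adL n) hab.le hK hKs (ρ a)
  have hc : ContinuousOn (u + d • v) (Icc a b) := hu.add (hv.const_smul d)
  refine ⟨σ, hσa, hσ, hK, hσs, hKs, h.contDiffOn_control.add (hv'.const_smul d), ⟨(u + d • v) a, ?_⟩,
    ⟨(u + d • v) b, ?_⟩, hσd, fun s hs => ?_⟩
  · rw [← nhdsWithin_Ioo_eq_nhdsGT hab]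
    exact (hc a (left_mem_Icc.2 hab.le)).mono Ioo_subset_Icc_self
  · rw [← nhdsWithin_Ioo_eq_nhdsLT hab]
    exact (hc b (right_mem_Icc.2 hab.le)).mono Ioo_subset_Icc_self
  · exact (h.hasDerivAt_ham s hs).add ((hwd s hs).const_smul d)

/-- The state depends on the perturbation of the control in a Lipschitz way at `0`. -/
theorem IsAdmissibleOn.exists_state_bound (h : IsAdmissibleOn 𝔥 a b ρ H u)
    {w : ℝ → UStar n} (hw : ContinuousOn w (Icc a b)) :
    ∃ G : ℝ, 0 ≤ G ∧ ∀ d ∈ Ioc (0 : ℝ) 1, ∀ (σ : ℝ → UStar n) (c : ℝ → 𝔥), σ a = ρ a →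
      IsAdmissibleOn 𝔥 a b σ (H + d • w) c → ∀ s ∈ Icc a b, ‖σ s - ρ s‖ ≤ d * G := by
  have had {f : ℝ → UStar n} (hf : ContinuousOn f (Icc a b)) :
      ContinuousOn (fun s => adL n (f s)) (Icc a b) := (adL n).continuous.comp_continuousOn hf
  obtain ⟨M₁, hM₁0, hM₁⟩ := exists_bilinear_bound (adL n) h.continuousOn_ham
  obtain ⟨M₂, hM₂0, hM₂⟩ := exists_bilinear_bound (adL n) hw
  obtain ⟨D, hD⟩ := isCompact_Icc.exists_bound_of_continuousOn
    ((had hw).clm_apply h.continuousOn_state)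
  -- For `d ≤ 1`, `M₁ + M₂` bounds the bracket with `H + d • w`; the summand `1` gives `M ≠ 0` for
  -- the closed form of the Grönwall bound.
  set M := M₁ + M₂ + 1 with hM
  have hM0 : 0 < M := by positivity
  refine ⟨|D| / M * Real.exp (M * (b - a)), by positivity, fun d hd σ c hσa hσ s hs => ?_⟩
  have hb := norm_le_gronwallBound_of_hasDerivAt_Ioo (K := M) (c := d * |D|)
    (x := fun s => σ s - ρ s)
    (x' := fun s => adL n ((H + d • w) s) (σ s - ρ s) + d • adL n (w s) (ρ s))
    (hσ.continuousOn_state.sub h.continuousOn_state)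
    (((had hσ.continuousOn_ham).clm_apply (hσ.continuousOn_state.sub h.continuousOn_state)).add
      (((had hw).clm_apply h.continuousOn_state).const_smul d))
    (by simp [hσa])
    (fun r hr => ((hσ.hasDerivAt_state r hr).sub (h.hasDerivAt_state r hr)).congr_deriv (by
      simp only [adL_apply, Pi.add_apply, Pi.smul_apply, lie_sub, add_lie, smul_lie]
      abel))
    (fun r hr => ?_) s hs
  · refine hb.trans ?_
    rw [gronwallBound_of_K_ne_0 hM0.ne']
    simp only [zero_mul, zero_add]
    have h1 : Real.exp (M * (s - a)) ≤ Real.exp (M * (b - a)) :=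
      Real.exp_le_exp.2 (by gcongr; exact hs.2)
    calc d * |D| / M * (Real.exp (M * (s - a)) - 1)
        ≤ d * |D| / M * Real.exp (M * (b - a)) := by
          refine mul_le_mul_of_nonneg_left (by linarith) ?_
          have := hd.1
          positivity
      _ = _ := by ring
  · refine (norm_add_le _ _).trans (add_le_add ?_ ?_)
    · simp only [Pi.add_apply, Pi.smul_apply, map_add, map_smul, add_apply, smul_apply]
      refine (norm_add_le _ _).trans ?_
      rw [norm_smul, Real.norm_of_nonneg hd.1.le]
      have h1 := hM₁ r hr (σ r - ρ r)
      have h2 := mul_le_mul hd.2 (hM₂ r hr (σ r - ρ r)) (norm_nonneg _) zero_le_one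
      have h3 := norm_nonneg (σ r - ρ r)
      linarith
    · rw [norm_smul, Real.norm_of_nonneg hd.1.le]
      exact mul_le_mul_of_nonneg_left ((hD r hr).trans (le_abs_self _)) hd.1.le

/-- The pairing of the costate with the variation of the state at the final time. -/
theorem IsAdmissibleOn.costate_apply_variation (h : IsAdmissibleOn 𝔥 a b ρ H u) (hab : a < b)
    {v : ℝ → 𝔥} (hv : ContinuousOn v (Icc a b))
    {w : ℝ → UStar n} (hw : ContinuousOn w (Icc a b))
    (hwd : ∀ s ∈ Ioo a b, HasDerivAt w (v s) s) (hwa : w a = 0)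
    {Γ P : ℝ → Costate n} (hΓ : ContinuousOn Γ (Icc a b)) (hP : ContinuousOn P (Icc a b))
    (hΓd : ∀ s ∈ Ioo a b, HasDerivAt Γ (-coad (H s) (Γ s)) s)
    (hPd : ∀ s ∈ Ioo a b, HasDerivAt P (coad (ρ s) (Γ s)) s) (hPb : P b = 0)
    {d : ℝ} {σ : ℝ → UStar n} {c : ℝ → 𝔥} (hσa : σ a = ρ a)
    (hσ : IsAdmissibleOn 𝔥 a b σ (H + d • w) c) :
    Γ b (σ b - ρ b) =
      d * (∫ s in a..b, coad (w s) (Γ s) (σ s - ρ s)) + d * ∫ s in a..b, P s (v s) := by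
  have he := hσ.continuousOn_state.sub h.continuousOn_state
  have hvc : ContinuousOn (fun s => (v s : UStar n)) (Icc a b) :=
    𝔥.subtypeL.continuous.comp_continuousOn hv
  have hc₁ : ContinuousOn (fun s => coad (w s) (Γ s) (σ s - ρ s)) (Icc a b) :=
    hΓ.clm_apply (((adL n).continuous.comp_continuousOn hw).clm_apply he)
  have hc₂ : ContinuousOn (fun s => P s (v s)) (Icc a b) := hP.clm_apply hvc
  have hi₁ := (hc₁.intervalIntegrable_of_Icc hab.le (μ := MeasureTheory.volume)).const_mul d
  have hi₂ := (hc₂.intervalIntegrable_of_Icc hab.le (μ := MeasureTheory.volume)).const_mul d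
  -- This function vanishes at `a`, where `σ = ρ` and `w = 0`, and reduces to `Γ b (σ b - ρ b)` at
  -- `b`, where `P = 0`.
  have hftc := intervalIntegral.integral_eq_sub_of_hasDerivAt_of_le hab.le
    (f := fun s => Γ s (σ s - ρ s) + d * P s (w s))
    (f' := fun s => d * coad (w s) (Γ s) (σ s - ρ s) + d * P s (v s))
    ((hΓ.clm_apply he).add (continuousOn_const.mul (hP.clm_apply hw))) (fun s hs => ?_)
    (hi₁.add hi₂)
  · rw [intervalIntegral.integral_add hi₁ hi₂, intervalIntegral.integral_const_mul,
      intervalIntegral.integral_const_mul] at hftc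
    rw [hftc]
    simp [hPb, hwa, hσa]
  · refine (((hΓd s hs).clm_apply
      ((hσ.hasDerivAt_state s hs).sub (h.hasDerivAt_state s hs))).add
      (((hPd s hs).clm_apply (hwd s hs)).const_mul d)).congr_deriv ?_
    -- The term `Γ ⁅ρ, w⁆` from `P'` cancels the part `Γ ⁅w, ρ⁆` of `Γ ⁅w, σ⁆`, leaving `Γ ⁅w, σ -
    -- ρ⁆`.
    have hskew : Γ s ⁅ρ s, w s⁆ = -Γ s ⁅w s, ρ s⁆ := by rw [← lie_skew, map_neg]
    simp only [neg_apply, coad_apply, Pi.add_apply, Pi.smul_apply, Pi.sub_apply,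
      add_lie, smul_lie, map_add, map_sub, map_smul, smul_eq_mul, hskew]
    ring

/-- An upper bound of second order for the cost of a perturbed process. -/
theorem IsAdmissibleOn.exists_cost_le (h : IsAdmissibleOn 𝔥 a b ρ H u) (hab : a < b)
    (hu : ContinuousOn u (Icc a b)) {v : ℝ → 𝔥} (hv : ContinuousOn v (Icc a b))
    (hv' : ContDiffOn ℝ ∞ v (Ioo a b))
    {Γ P : ℝ → Costate n} (hΓ : ContinuousOn Γ (Icc a b)) (hP : ContinuousOn P (Icc a b))
    (hΓd : ∀ s ∈ Ioo a b, HasDerivAt Γ (-coad (H s) (Γ s)) s)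
    (hPd : ∀ s ∈ Ioo a b, HasDerivAt P (coad (ρ s) (Γ s)) s)
    (hΓb : Γ b = -((1 / ε) • flat (ρ b - target))) (hPb : P b = 0) :
    ∃ C : ℝ, ∀ d ∈ Ioc (0 : ℝ) 1, ∃ (σ K : ℝ → UStar n) (c : ℝ → 𝔥),
      IsAdmissibleOn 𝔥 a b σ K c ∧ σ a = ρ a ∧ K a = H a ∧
      cost 𝔥 ε a b target σ c ≤ cost 𝔥 ε a b target ρ u +
        d * (∫ s in a..b, (inner ℝ (u s : UStar n) (v s : UStar n) - P s (v s))) + C * d ^ 2 := by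
  have huc : ContinuousOn (fun s => (u s : UStar n)) (Icc a b) :=
    𝔥.subtypeL.continuous.comp_continuousOn hu
  have hvc : ContinuousOn (fun s => (v s : UStar n)) (Icc a b) :=
    𝔥.subtypeL.continuous.comp_continuousOn hv
  obtain ⟨w, hw, hwa, hwd⟩ := exists_primitive (c := a) hab.le hvc
  obtain ⟨G, hG0, hG⟩ := h.exists_state_bound hw.continuousOn
  obtain ⟨D, hD0, hD⟩ := exists_dual_bilinear_bound (adL n) hw.continuousOn hΓ
  -- The three summands come from the quadratic part of the running cost, the remainder `Γ ⁅w, σ -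
  -- ρ⁆`, and the quadratic part of the terminal cost.
  refine ⟨(∫ s in a..b, 1 / 2 * ‖(v s : UStar n)‖ ^ 2) + D * G * (b - a) +
    |1 / ε| * (1 / 2 * G ^ 2), fun d hd => ?_⟩
  obtain ⟨σ, hσa, hσ⟩ := h.exists_perturbation hab hu hv hv' hw.continuousOn hwd d
  refine ⟨σ, _, _, hσ, hσa, by simp [hwa], ?_⟩
  have hpair := h.costate_apply_variation hab hv hw.continuousOn hwd hwa hΓ hP hΓd hPd hPb hσa hσ
  have hgb := hG d hd σ _ hσa hσ
  have hint : ‖∫ s in a..b, coad (w s) (Γ s) (σ s - ρ s)‖ ≤ D * (d * G) * |b - a| := by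
    refine intervalIntegral.norm_integral_le_of_norm_le_const fun s hs => ?_
    rw [uIoc_of_le hab.le] at hs
    have hs' := Ioc_subset_Icc_self hs
    exact (hD s hs' _).trans (mul_le_mul_of_nonneg_left (hgb s hs') hD0)
  rw [abs_of_pos (sub_pos.2 hab), Real.norm_eq_abs] at hint
  have hint' := (abs_le.1 hint).1
  have hi {f : ℝ → ℝ} (hf : ContinuousOn f (Icc a b)) :
      IntervalIntegrable f MeasureTheory.volume a b := hf.intervalIntegrable_of_Icc hab.le
  have hiu := hi (f := fun s => 1 / 2 * ‖(u s : UStar n)‖ ^ 2) (by fun_prop)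
  have hiv := hi (f := fun s => 1 / 2 * ‖(v s : UStar n)‖ ^ 2) (by fun_prop)
  have hiuv := hi (f := fun s => inner ℝ (u s : UStar n) (v s : UStar n)) (huc.inner hvc)
  have hiP := hi (f := fun s => P s (v s)) (hP.clm_apply hvc)
  have hrun : (∫ s in a..b, 1 / 2 * ‖((u + d • v) s : UStar n)‖ ^ 2) =
      (∫ s in a..b, 1 / 2 * ‖(u s : UStar n)‖ ^ 2) +
      d * (∫ s in a..b, inner ℝ (u s : UStar n) (v s : UStar n)) +
      d ^ 2 * ∫ s in a..b, 1 / 2 * ‖(v s : UStar n)‖ ^ 2 := by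
    rw [← intervalIntegral.integral_const_mul, ← intervalIntegral.integral_const_mul,
      ← intervalIntegral.integral_add hiu (hiuv.const_mul d),
      ← intervalIntegral.integral_add (hiu.add (hiuv.const_mul d)) (hiv.const_mul _)]
    refine intervalIntegral.integral_congr fun s _ => ?_
    simp only [Pi.add_apply, Pi.smul_apply, Submodule.coe_add, Submodule.coe_smul]
    rw [norm_add_sq_real, norm_smul, inner_smul_right, mul_pow, Real.norm_eq_abs, sq_abs]
    ring
  have hterm : ‖σ b - target‖ ^ 2 = ‖ρ b - target‖ ^ 2 +
      2 * inner ℝ (ρ b - target) (σ b - ρ b) + ‖σ b - ρ b‖ ^ 2 := by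
    rw [← norm_add_sq_real]
    congr 2
    abel
  -- The final value of `Γ` is chosen for this: the linear part of the terminal cost becomes a
  -- pairing already computed in `hpair`.
  have hΓe : 1 / ε * inner ℝ (ρ b - target) (σ b - ρ b) = -Γ b (σ b - ρ b) := by
    rw [hΓb]
    simp [flat_apply]
  have hsq : 1 / ε * (1 / 2 * ‖σ b - ρ b‖ ^ 2) ≤ |1 / ε| * (1 / 2 * G ^ 2) * d ^ 2 := by
    have h1 : ‖σ b - ρ b‖ ^ 2 ≤ (d * G) ^ 2 :=
      pow_le_pow_left₀ (norm_nonneg _) (hgb b (right_mem_Icc.2 hab.le)) 2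
    calc 1 / ε * (1 / 2 * ‖σ b - ρ b‖ ^ 2) ≤ |1 / ε| * (1 / 2 * ‖σ b - ρ b‖ ^ 2) :=
          mul_le_mul_of_nonneg_right (le_abs_self _) (by positivity)
      _ ≤ |1 / ε| * (1 / 2 * (d * G) ^ 2) := by gcongr
      _ = _ := by ring
  have hcross := mul_le_mul_of_nonneg_left hint' hd.1.le
  rw [cost, cost, hrun, hterm, intervalIntegral.integral_sub hiuv hiP]
  rw [hpair] at hΓe
  linarith

/-- A quadratic function of one variable that is nonnegative for small positive arguments has a
nonnegative linear coefficient. -/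
theorem nonneg_of_forall_mul_add_sq_nonneg {I C : ℝ}
    (h : ∀ d ∈ Ioc (0 : ℝ) 1, 0 ≤ d * I + C * d ^ 2) : 0 ≤ I := by
  have hlim : Tendsto (fun d : ℝ => I + C * d) (𝓝[>] 0) (𝓝 (I + C * 0)) :=
    (Continuous.tendsto (by fun_prop) 0).mono_left nhdsWithin_le_nhds
  rw [mul_zero, add_zero] at hlim
  refine ge_of_tendsto hlim ?_
  filter_upwards [Ioc_mem_nhdsGT zero_lt_one] with d hd
  have h1 := h d hd
  rw [show d * I + C * d ^ 2 = d * (I + C * d) by ring] at h1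
  exact nonneg_of_mul_nonneg_right h1 hd.1

/-- The maximum principle for one subproblem. -/
theorem IsOptimalOn.exists_costate (h : IsOptimalOn 𝔥 ε a b target ρ H u) (hab : a < b) :
    ∃ Γ P : ℝ → Costate n, ContinuousOn Γ (Icc a b) ∧ ContinuousOn P (Icc a b) ∧
      (∀ s ∈ Ioo a b, HasDerivAt Γ (-coad (H s) (Γ s)) s ∧
        HasDerivAt P (coad (ρ s) (Γ s)) s ∧ ∀ v ∈ 𝔥, P s v = flat (u s : UStar n) v) ∧
      Γ b = -((1 / ε) • flat (ρ b - target)) ∧ P b = 0 := by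
  obtain ⟨u', hu', heq⟩ := h.1.exists_control_continuousOn
  have h' := h.congr_control hab heq
  obtain ⟨Γ, P, hΓ, hP, hΓd, hPd, hPs, hΓb, hPb⟩ :=
    exists_bilinear_adjoint (adL n) hab.le h'.1.continuousOn_state h'.1.contDiffOn_state
      h'.1.continuousOn_ham h'.1.contDiffOn_ham (-((1 / ε) • flat (ρ b - target)))
  -- The direction of steepest descent: minus the `L²` gradient of the cost.
  set v : ℝ → 𝔥 := fun s => rieszProj 𝔥 (P s) - u' s
  have hv : ContinuousOn v (Icc a b) := (continuousOn_rieszProj 𝔥 hP).sub hu'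
  have hvs : ContDiffOn ℝ ∞ v (Ioo a b) :=
    (contDiffOn_rieszProj 𝔥 hPs).sub h'.1.contDiffOn_control
  obtain ⟨C, hC⟩ := h'.1.exists_cost_le hab hu' hv hvs hΓ hP hΓd hPd hΓb hPb
  have hint : 0 ≤ ∫ s in a..b, (inner ℝ (u' s : UStar n) (v s : UStar n) - P s (v s)) := by
    refine nonneg_of_forall_mul_add_sq_nonneg (C := C) fun d hd => ?_
    obtain ⟨σ, K, c, hadm, hσ, hK, hle⟩ := hC d hd
    have := h'.2 σ K c hadm hσ hK
    linarith
  have hsq (s : ℝ) : inner ℝ (u' s : UStar n) (v s : UStar n) - P s (v s) = -‖v s‖ ^ 2 := by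
    rw [← inner_rieszProj, ← inner_sub_left, ← neg_sub, inner_neg_left]
    rw [← Submodule.coe_sub]
    exact congrArg Neg.neg (real_inner_self_eq_norm_sq (v s))
  simp only [hsq, intervalIntegral.integral_neg] at hint
  have hv0 : ∀ s ∈ Icc a b, v s = 0 := fun s hs => by
    by_contra hne
    have := intervalIntegral.integral_pos hab (f := fun s => ‖v s‖ ^ 2) (by fun_prop)
      (fun _ _ => by positivity) ⟨s, hs, by positivity⟩
    linarith
  refine ⟨Γ, P, hΓ, hP, fun s hs => ⟨hΓd s hs, hPd s hs, fun y hy => ?_⟩, hΓb, hPb⟩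
  have h1 : rieszProj 𝔥 (P s) = u s := by
    rw [← heq hs]
    exact sub_eq_zero.1 (hv0 s (Ioo_subset_Icc_self hs))
  rw [flat_apply, ← h1, inner_rieszProj 𝔥 (P s) ⟨y, hy⟩]

end OneInterval

/-! ### Gluing the subproblems of the chain -/

/-- Functions given on the pieces of a subdivision come from one function on the line. -/
theorem exists_eqOn_Ioo {N : ℕ} {F : Type*} [Nonempty F] {t : Fin (N + 1) → ℝ} (ht : StrictMono t)
    (f : Fin N → ℝ → F) :
    ∃ g : ℝ → F, ∀ j : Fin N, EqOn g (f j) (Ioo (t j.castSucc) (t j.succ)) := by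
  classical
  refine ⟨fun s => if h : ∃ j : Fin N, s ∈ Ioo (t j.castSucc) (t j.succ) then f h.choose s
    else Classical.arbitrary F, fun j s hs => ?_⟩
  have h : ∃ j : Fin N, s ∈ Ioo (t j.castSucc) (t j.succ) := ⟨j, hs⟩
  have hk := h.choose_spec
  -- Two pieces with a common point have indices `k < j + 1` and `j < k + 1`.
  have hjk : h.choose = j := by
    have h1 := ht.lt_iff_lt.1 (hk.1.trans hs.2)
    have h2 := ht.lt_iff_lt.1 (hs.1.trans hk.2)
    rw [Fin.lt_def, Fin.val_castSucc, Fin.val_succ] at h1 h2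
    exact Fin.ext (by omega)
  simp only [dif_pos h, hjk]

end QuantumSpline

theorem theorem2 (n N : ℕ) (𝔥 : Submodule ℝ (QuantumSpline.UStar n))
    (T ε : ℝ) (hT : 0 < T) (hε : 0 < ε)
    (t : Fin (N + 1) → ℝ) (ht : StrictMono t) (ht0 : t 0 = 0) (htN : t (Fin.last N) = T)
    (target : Fin (N + 1) → QuantumSpline.UStar n)
    (htarget : ∀ j, QuantumSpline.IsDensity (target j))
    (H₀ : QuantumSpline.UStar n)
    (ρ H : ℝ → QuantumSpline.UStar n) (u : ℝ → 𝔥)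
    (hopt : QuantumSpline.IsOptimalChain 𝔥 ε t target H₀ ρ H u) :
    ∃ Γ P : ℝ → QuantumSpline.Costate n,
      QuantumSpline.PiecewiseContinuous t Γ ∧ QuantumSpline.PiecewiseContinuous t P ∧
      (∀ j : Fin N, ∀ s ∈ Ioo (t j.castSucc) (t j.succ),
        HasDerivAt ρ ⁅H s, ρ s⁆ s ∧
        HasDerivAt H (u s : QuantumSpline.UStar n) s ∧
        HasDerivAt Γ (-QuantumSpline.coad (H s) (Γ s)) s ∧
        HasDerivAt P (QuantumSpline.coad (ρ s) (Γ s)) s ∧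
        ∀ v ∈ 𝔥, P s v = QuantumSpline.flat (u s : QuantumSpline.UStar n) v) ∧
      (ρ 0 = target 0 ∧ H 0 = H₀) ∧
      ∀ j : Fin N,
        Tendsto Γ (𝓝[<] (t j.succ))
          (𝓝 (-((1 / ε) • QuantumSpline.flat (ρ (t j.succ) - target j.succ)))) ∧
        Tendsto P (𝓝[<] (t j.succ)) (𝓝 0) := by
  -- No condition links the costates of consecutive pieces, so they are chosen independently and may
  -- jump at the nodes.
  choose Γ' P' hΓ hP hd hΓb hPb using fun j : Fin N =>
    (hopt.isOptimalOn j).exists_costate (ht (Fin.castSucc_lt_succ (i := j)))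
  obtain ⟨Γ, hΓeq⟩ := QuantumSpline.exists_eqOn_Ioo ht Γ'
  obtain ⟨P, hPeq⟩ := QuantumSpline.exists_eqOn_Ioo ht P'
  have hlt (j : Fin N) : t j.castSucc < t j.succ := ht Fin.castSucc_lt_succ
  have hleft {f : ℝ → QuantumSpline.Costate n} {g : Fin N → ℝ → QuantumSpline.Costate n}
      (hg : ∀ j, ContinuousOn (g j) (Icc (t j.castSucc) (t j.succ)))
      (hfg : ∀ j, EqOn f (g j) (Ioo (t j.castSucc) (t j.succ))) (j : Fin N) :
      Tendsto f (𝓝[<] (t j.succ)) (𝓝 (g j (t j.succ))) := by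
    rw [← nhdsWithin_Ioo_eq_nhdsLT (hlt j)]
    exact (((hg j) _ (right_mem_Icc.2 (hlt j).le)).mono Ioo_subset_Icc_self).congr'
      (eventually_nhdsWithin_of_forall fun s hs => (hfg j hs).symm)
  have hright {f : ℝ → QuantumSpline.Costate n} {g : Fin N → ℝ → QuantumSpline.Costate n}
      (hg : ∀ j, ContinuousOn (g j) (Icc (t j.castSucc) (t j.succ)))
      (hfg : ∀ j, EqOn f (g j) (Ioo (t j.castSucc) (t j.succ))) (j : Fin N) :
      Tendsto f (𝓝[>] (t j.castSucc)) (𝓝 (g j (t j.castSucc))) := by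
    rw [← nhdsWithin_Ioo_eq_nhdsGT (hlt j)]
    exact (((hg j) _ (left_mem_Icc.2 (hlt j).le)).mono Ioo_subset_Icc_self).congr'
      (eventually_nhdsWithin_of_forall fun s hs => (hfg j hs).symm)
  refine ⟨Γ, P,
    fun j => ⟨((hΓ j).mono Ioo_subset_Icc_self).congr (hΓeq j), ⟨_, hright hΓ hΓeq j⟩,
      ⟨_, hleft hΓ hΓeq j⟩⟩,
    fun j => ⟨((hP j).mono Ioo_subset_Icc_self).congr (hPeq j), ⟨_, hright hP hPeq j⟩,
      ⟨_, hleft hP hPeq j⟩⟩,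
    fun j s hs => ?_, ⟨ht0 ▸ hopt.initial_state, ht0 ▸ hopt.initial_ham⟩,
    fun j => ⟨hΓb j ▸ hleft hΓ hΓeq j, hPb j ▸ hleft hP hPeq j⟩⟩
  obtain ⟨hΓd, hPd, hmax⟩ := hd j s hs
  -- The glued costates agree with the pieces near `s`, so derivatives carry over.
  have hs' := isOpen_Ioo.mem_nhds hs
  refine ⟨(hopt.isOptimalOn j).1.hasDerivAt_state s hs, (hopt.isOptimalOn j).1.hasDerivAt_ham s hs,
    ?_, ?_, ?_⟩
  · rw [hΓeq j hs]
    exact hΓd.congr_of_eventuallyEq ((hΓeq j).eventuallyEq_of_mem hs')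
  · rw [hΓeq j hs]
    exact hPd.congr_of_eventuallyEq ((hPeq j).eventuallyEq_of_mem hs')
  · rw [hPeq j hs]
    exact hmax
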